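/- Let $K$ be a field, let $P_1,\dots,P_s \in \mathbb{P}^n = \mathbb{P}^n_K$ ($s \ge 1$) be distinct $K$-rational points, and let $m_1,\dots,m_s$ be positive integers. The fat point scheme $X = \sum_{i=1}^s m_i P_i$ is the subscheme of $\mathbb{P}^n$ with homogeneous ideal $I_X = \bigcap_{i=1}^s I_{P_i}^{m_i} \subset R = K[x_0,\dots,x_n]$, where $I_{P}$ denotes the homogeneous ideal of the point $P$. Its regularity index $r(X)$ is the least integer $j$ such that $X$ imposes independent conditions on forms of degree $j$, that is, such that $\dim_K [R/I_X]_j = \deg X = \sum_{i=1}^s \binom{m_i+n-1}{n}$ (such a least integer exists). Let $d \ge 1$, let $v_d : \mathbb{P}^n \to \mathbb{P}^N$, $N = \binom{n+d}{n} - 1$, be the $d$-th Veronese embedding, given by all monomials of degree $d$, and let $\hat{X} = \sum_{i=1}^s m_i\, v_d(P_i) \subset \mathbb{P}^N$. Then $$\left\lceil \frac{r(X)}{d} \right\rceil \le r(\hat{X}).$$ Moreover, if $n = 1$, $s \ge 2$, and $d(m_j + m_k) \le 2d - 2 + \sum_{i=1}^s m_i$ for all integers $j,k$ with $1 \le j <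 k \le s$, then this is an equality and $$r(\hat{X}) = \left\lceil \frac{-1 + \sum_{i=1}^s m_i}{d} \right\rceil .$$ -/

import Mathlib

open scoped LinearAlgebra.Projectivization

noncomputable section

namespace FatPoints

variable {K : Type*} [Field K] {σ : Type*} [Fintype σ] {ι : Type*} [Fintype ι]

/-- The dimension `n` of the projective space `ℙ K (σ → K)` with homogeneous coordinates
`x_i`, `i ∈ σ`, where `|σ| = n + 1`. -/
def projDim (σ : Type*) [Fintype σ] : ℕ := Fintype.card σ - 1

/-- The homogeneous ideal `I_P` of a point `P`: it is generated by the homogeneous polynomials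
that vanish at `P`, i.e. at every vector of the line that `P` represents. -/
def pointIdeal (P : ℙ K (σ → K)) : Ideal (MvPolynomial σ K) :=
  Ideal.span {f | (∃ j : ℕ, f.IsHomogeneous j) ∧ ∀ v ∈ P.submodule, MvPolynomial.eval v f = 0}

/-- The homogeneous ideal `I_X = ⋂ I_{P_i} ^ {m_i}` of the fat point scheme `X = ∑ m_i P_i`. -/
def fatPointIdeal (P : ι → ℙ K (σ → K)) (m : ι → ℕ) : Ideal (MvPolynomial σ K) :=
  ⨅ i, pointIdeal (P i) ^ m i

/-- The Hilbert function `j ↦ dim_K [R / I]_j` of `R / I`, where `R` is the polynomial ring and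
`I` is a homogeneous ideal, computed as `dim_K [R]_j / [I]_j`; it is zero for `j < 0`. -/
def hilbertFunction (I : Ideal (MvPolynomial σ K)) : ℤ → ℕ
  | Int.ofNat j => Module.finrank K
      (MvPolynomial.homogeneousSubmodule σ K j ⧸
        (I.restrictScalars K).submoduleOf (MvPolynomial.homogeneousSubmodule σ K j))
  | Int.negSucc _ => 0

/-- The degree of `X = ∑ m_i P_i ⊂ ℙ^n` with distinct points `P_i`, where `n = projDim σ`:
vanishing to order `m` at a point amounts to `(m + n - 1).choose n` linear conditions. -/
def fatPointDegree (σ : Type*) [Fintype σ] (m : ι → ℕ) : ℕ :=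
  ∑ i, (m i + projDim σ - 1).choose (projDim σ)

/-- The degrees `j` such that `X = ∑ m_i P_i` imposes independent conditions on forms of
degree `j`. -/
def independentDegrees (P : ι → ℙ K (σ → K)) (m : ι → ℕ) : Set ℤ :=
  {j | hilbertFunction (fatPointIdeal P m) j = fatPointDegree σ m}

/-- The regularity index `r(X)` of `X = ∑ m_i P_i`: the least integer `j` such that `X` imposes
independent conditions on forms of degree `j`. -/
def regularityIndex (P : ι → ℙ K (σ → K)) (m : ι → ℕ) : ℤ :=
  sInf (independentDegrees P m)

/-- The exponent vectors `a : σ → ℕ` of the monomials `x ^ a` of degree `d`. -/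
abbrev Exponents (σ : Type*) [Fintype σ] [DecidableEq σ] (d : ℕ) : Type _ :=
  ↥(Finset.piAntidiag (Finset.univ : Finset σ) d)

/-- The affine Veronese map `v ↦ (v ^ a)_a`, where `x ^ a` runs over the monomials of degree
`d`. -/
def veroneseVec [DecidableEq σ] (d : ℕ) (v : σ → K) : Exponents σ d → K :=
  fun a => ∏ i, v i ^ (a : σ → ℕ) i

theorem veroneseVec_ne_zero [DecidableEq σ] (d : ℕ) {v : σ → K} (hv : v ≠ 0) :
    veroneseVec d v ≠ 0 := by
  obtain ⟨i, hi⟩ := Function.ne_iff.mp hv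
  intro h
  have hmem : (Pi.single i d : σ → ℕ) ∈ Finset.piAntidiag (Finset.univ : Finset σ) d := by
    simp [Finset.mem_piAntidiag]
  have h1 := congrFun h ⟨_, hmem⟩
  simp only [veroneseVec, Pi.zero_apply, Finset.prod_eq_zero_iff] at h1
  obtain ⟨k, -, hk⟩ := h1
  by_cases hki : k = i
  · subst hki
    exact hi (eq_zero_of_pow_eq_zero hk)
  · simp [Pi.single_eq_of_ne hki] at hk

theorem veroneseVec_smul [DecidableEq σ] (d : ℕ) (t : K) (v : σ → K) :
    veroneseVec d (t • v) = t ^ d • veroneseVec d v := by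
  funext a
  have ha : ∑ i, (a : σ → ℕ) i = d := (Finset.mem_piAntidiag.mp a.2).1
  simp [veroneseVec, mul_pow, Finset.prod_mul_distrib, Finset.prod_pow_eq_pow_sum, ha]

/-- The `d`-th Veronese embedding `v_d : ℙ^n → ℙ^N`, where the coordinates of `ℙ^N` are indexed
by the monomials of degree `d` in the coordinates of `ℙ^n`. -/
def veronese [DecidableEq σ] (d : ℕ) : ℙ K (σ → K) → ℙ K (Exponents σ d → K) :=
  Projectivization.lift
    (fun v => Projectivization.mk K (veroneseVec d v.1) (veroneseVec_ne_zero d v.2))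
    (by
      rintro ⟨a, ha⟩ ⟨b, hb⟩ t h
      rw [Projectivization.mk_eq_mk_iff']
      refine ⟨t ^ d, ?_⟩
      change a = t • b at h
      change t ^ d • veroneseVec d b = veroneseVec d a
      rw [h, veroneseVec_smul])

end FatPoints

end

noncomputable section

namespace FatPoints

open MvPolynomial

/-! ### Local description of fat points in affine charts. -/

section

variable {K : Type*} [Field K] {σ : Type*}

/-! In an affine chart, a form lies in `I_P ^ m` exactly when its Taylor coefficients of order below
`m` at `P` vanish (`mem_pow_pointIdeal_iff`). So `X` imposes independent conditions in degree `j`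
iff forms of degree `j` realize all prescribed jets (`natCast_mem_independentDegrees_iff`), and only
jets need to be interpolated.

Inequality: the substitution `y_a ↦ x ^ a` turns forms of degree `j` into forms of degree `d * j`,
and every jet at `P` comes from a jet at `v_d(P)`. Hence `r(X) ≤ d * r(X̂)`
(`SurjectiveOnJets.of_veronese`).

Equality for `n = 1`: binary forms of degree `j` have dimension at most `j + 1`, so `∑ m_i ≤ r(X) +
1` (`SurjectiveOnJets.sum_le`). Conversely, products of at most `d` linear forms give hyperplanes
separating any `d` Veronese points from another one. This is the general position needed in
`surjectiveOnJets_of_separated`, so jets are attained in degree `t` once `m_i + m_k ≤ t + 1` and `∑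
m_i ≤ d * t + 1`. The hypothesis on pairs makes `t = ⌈(∑ m_i - 1) / d⌉` admissible, and the two
bounds meet. -/

theorem mem_idealOfVars_iff {τ : Type*} (f : MvPolynomial τ K) :
    f ∈ idealOfVars τ K ↔ constantCoeff f = 0 := by
  rw [← pow_one (idealOfVars τ K), mem_pow_idealOfVars_iff']
  simp [constantCoeff_eq, Finsupp.degree_eq_zero_iff]

theorem eval_smul_of_isHomogeneous {τ : Type*} {f : MvPolynomial τ K} {j : ℕ}
    (hf : f.IsHomogeneous j) (t : K) (v : τ → K) : eval (t • v) f = t ^ j * eval v f := by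
  rw [eval_eq, eval_eq, Finset.mul_sum]
  refine Finset.sum_congr rfl fun b hb => ?_
  have hb' : b.degree = j := by
    by_contra h
    exact (mem_support_iff.1 hb) (hf.coeff_eq_zero h)
  simp only [Pi.smul_apply, smul_eq_mul, mul_pow, Finset.prod_mul_distrib,
    Finset.prod_pow_eq_pow_sum]
  rw [← hb', Finsupp.degree_apply]
  ring

theorem mem_pointIdeal {w : σ → K} (hw : w ≠ 0) {f : MvPolynomial σ K} {j : ℕ}
    (hf : f.IsHomogeneous j) (h0 : eval w f = 0) :
    f ∈ pointIdeal (Projectivization.mk K w hw) := by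
  refine Ideal.subset_span ⟨⟨j, hf⟩, fun v hv => ?_⟩
  rw [Projectivization.submodule_mk, Submodule.mem_span_singleton] at hv
  obtain ⟨t, rfl⟩ := hv
  rw [eval_smul_of_isHomogeneous hf, h0, mul_zero]

/-- The linear form `x_k - w_k x_c`. -/
def chartForm (w : σ → K) (c k : σ) : MvPolynomial σ K := X k - C (w k) * X c

theorem isHomogeneous_chartForm (w : σ → K) (c k : σ) : (chartForm w c k).IsHomogeneous 1 :=
  (isHomogeneous_X K k).sub (isHomogeneous_C_mul_X _ _)

theorem eval_chartForm (w v : σ → K) (c k : σ) :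
    eval v (chartForm w c k) = v k - w k * v c := by simp [chartForm]

/-- The `K`-linear map that turns polynomials on the affine chart into forms of degree `j`. -/
def homogenizeChart (w : σ → K) (c : σ) (j : ℕ) :
    MvPolynomial {k // k ≠ c} K →ₗ[K] MvPolynomial σ K :=
  (basisMonomials _ K).constr K fun a =>
    X c ^ (j - a.degree) * a.prod fun k e => chartForm w c k ^ e

theorem homogenizeChart_monomial (w : σ → K) (c : σ) (j : ℕ) (a : {k // k ≠ c} →₀ ℕ) (r : K) :
    homogenizeChart w c j (monomial a r) =
      r • (X c ^ (j - a.degree) * a.prod fun k e => chartForm w c k ^ e) := by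
  have h : monomial a r = r • basisMonomials _ K a := by
    simp [smul_monomial]
  rw [h, map_smul, homogenizeChart, Module.Basis.constr_basis]

theorem homogenizeChart_mem_pow {w : σ → K} (hw : w ≠ 0) {c : σ} (hc : w c = 1) (j : ℕ) {m : ℕ}
    {g : MvPolynomial {k // k ≠ c} K} (hg : g ∈ idealOfVars {k // k ≠ c} K ^ m) :
    homogenizeChart w c j g ∈ pointIdeal (Projectivization.mk K w hw) ^ m := by
  rw [mem_pow_idealOfVars_iff] at hg
  rw [g.as_sum, map_sum]
  refine sum_mem fun a ha => ?_
  rw [homogenizeChart_monomial]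
  refine Submodule.smul_of_tower_mem _ _ (Ideal.mul_mem_left _ _ ?_)
  refine Ideal.pow_le_pow_right (hg a ha) ?_
  rw [Finsupp.degree_apply, ← Finset.prod_pow_eq_pow_sum]
  refine Ideal.prod_mem_prod fun k _ => Ideal.pow_mem_pow ?_ _
  exact mem_pointIdeal hw (isHomogeneous_chartForm w c k) (by simp [eval_chartForm, hc])

variable [DecidableEq σ]

/-- Restriction of polynomials to the affine chart `x_c = 1`, with the origin moved to `w`. -/
def chart (w : σ → K) (c : σ) : MvPolynomial σ K →ₐ[K] MvPolynomial {k // k ≠ c} K :=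
  aeval fun k => if h : k = c then 1 else X ⟨k, h⟩ + C (w k)

@[simp]
theorem chart_X_self (w : σ → K) (c : σ) : chart w c (X c) = 1 := by simp [chart]

theorem chart_X_of_ne (w : σ → K) {c k : σ} (h : k ≠ c) :
    chart w c (X k) = X ⟨k, h⟩ + C (w k) := by simp [chart, h]

theorem chart_C (w : σ → K) (c : σ) (r : K) : chart w c (C r) = C r := by
  simp [chart]

theorem constantCoeff_chart {w : σ → K} {c : σ} (hc : w c = 1) (f : MvPolynomial σ K) :
    constantCoeff (chart w c f) = eval w f := by
  induction f using MvPolynomial.induction_on with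
  | C a => simp
  | add p q hp hq => simp [hp, hq]
  | mul_X p k hp =>
    by_cases h : k = c
    · subst h; simp [hp, hc]
    · simp [hp, chart_X_of_ne w h]

theorem chart_mem_idealOfVars_iff {w : σ → K} {c : σ} (hc : w c = 1) (f : MvPolynomial σ K) :
    chart w c f ∈ idealOfVars {k // k ≠ c} K ↔ eval w f = 0 := by
  rw [mem_idealOfVars_iff, constantCoeff_chart hc]

theorem pointIdeal_le_comap_chart {w : σ → K} (hw : w ≠ 0) {c : σ} (hc : w c = 1) :
    pointIdeal (Projectivization.mk K w hw) ≤ (idealOfVars {k // k ≠ c} K).comap (chart w c) := by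
  refine Ideal.span_le.2 fun f hf => ?_
  refine (chart_mem_idealOfVars_iff hc f).2 (hf.2 w ?_)
  rw [Projectivization.submodule_mk]
  exact Submodule.mem_span_singleton_self w

theorem chart_mem_pow_of_mem {w : σ → K} (hw : w ≠ 0) {c : σ} (hc : w c = 1) {m : ℕ}
    {f : MvPolynomial σ K} (hf : f ∈ pointIdeal (Projectivization.mk K w hw) ^ m) :
    chart w c f ∈ idealOfVars {k // k ≠ c} K ^ m :=
  Ideal.le_comap_pow (chart w c) m (Ideal.pow_right_mono (pointIdeal_le_comap_chart hw hc) m hf)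

theorem chart_chartForm (w : σ → K) {c k : σ} (h : k ≠ c) :
    chart w c (chartForm w c k) = X ⟨k, h⟩ := by
  simp [chartForm, chart_X_of_ne w h]

/-- The linear change of coordinates `x_k ↦ x_k - w_k x_c` for `k ≠ c`. -/
def shear (w : σ → K) (c : σ) : MvPolynomial σ K →ₐ[K] MvPolynomial σ K :=
  aeval fun k => if k = c then X c else chartForm w c k

theorem shear_shear_neg (w : σ → K) (c : σ) (f : MvPolynomial σ K) :
    shear w c (shear (-w) c f) = f := by
  suffices h : (shear w c).comp (shear (-w) c) = AlgHom.id K _ from DFunLike.congr_fun h f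
  ext1 k
  by_cases h : k = c
  · subst h; simp [shear]
  · simp [shear, h, chartForm, algHom_C]

theorem isHomogeneous_shear (w : σ → K) (c : σ) {f : MvPolynomial σ K} {j : ℕ}
    (hf : f.IsHomogeneous j) : (shear w c f).IsHomogeneous j := by
  have := hf.aeval (S := K) (fun k => if k = c then X c else chartForm w c k) (n := 1) ?_
  · simpa [shear] using this
  · intro k
    split_ifs
    exacts [isHomogeneous_X _ _, isHomogeneous_chartForm w c k]

/-- The shear sends a monomial `x ^ b` to `x_c ^ b_c` times powers of the `chartForm`s, and the
chart turns this into a single monomial. Only the exponent of `x_c` is lost, and the degree `j`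
recovers it. -/
theorem homogenizeChart_chart_shear [Fintype σ] (w : σ → K) (c : σ) {f : MvPolynomial σ K} {j : ℕ}
    (hf : f.IsHomogeneous j) :
    homogenizeChart w c j (chart w c (shear w c f)) = shear w c f := by
  rw [f.as_sum]
  simp only [map_sum]
  refine Finset.sum_congr rfl fun b hb => ?_
  have hb' : b.degree = j := by
    by_contra h
    exact (mem_support_iff.1 hb) (hf.coeff_eq_zero h)
  generalize coeff b f = r
  have hshear : shear w c (monomial b r) =
      C r * (X c ^ b c * ∏ k : {k // k ≠ c}, chartForm w c k ^ b k) := by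
    rw [shear, aeval_monomial, Finsupp.prod_fintype _ _ fun k => pow_zero _,
      Fintype.prod_eq_mul_prod_subtype_ne _ c]
    congr 2
    · simp
    · exact Finset.prod_congr rfl fun k _ => by simp [k.2]
  have hdeg : j - (b.subtypeDomain (· ≠ c)).degree = b c := by
    rw [← hb', Finsupp.degree_eq_sum, Finsupp.degree_eq_sum,
      Fintype.sum_eq_add_sum_subtype_ne _ c]
    simp
  have hchart : chart w c (shear w c (monomial b r)) =
      monomial (b.subtypeDomain (· ≠ c)) r := by
    rw [hshear, monomial_eq, Finsupp.prod_fintype _ _ fun k => pow_zero _]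
    simp only [map_mul, map_pow, map_prod, chart_X_self, one_pow, one_mul, chart_C]
    congr 1
    exact Finset.prod_congr rfl fun k _ => by simp [chart_chartForm w k.2]
  rw [hchart, homogenizeChart_monomial, hdeg, hshear, smul_eq_C_mul,
    Finsupp.prod_fintype _ _ fun k => pow_zero _]
  rfl

/-- The shear is onto, so every form of degree `j` is recovered from its chart by `homogenizeChart`,
which sends order at least `m` at the origin into `I_P ^ m`. -/
theorem mem_pow_pointIdeal_iff [Fintype σ] {w : σ → K} (hw : w ≠ 0) {c : σ} (hc : w c = 1) {m j : ℕ}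
    {f : MvPolynomial σ K} (hf : f.IsHomogeneous j) :
    f ∈ pointIdeal (Projectivization.mk K w hw) ^ m ↔
      chart w c f ∈ idealOfVars {k // k ≠ c} K ^ m := by
  refine ⟨chart_mem_pow_of_mem hw hc, fun h => ?_⟩
  rw [← shear_shear_neg w c f,
    ← homogenizeChart_chart_shear w c (isHomogeneous_shear (-w) c hf), shear_shear_neg]
  exact homogenizeChart_mem_pow hw hc j h

end

/-! ### Independent conditions as surjectivity onto jets. -/

section

theorem finite_degree_lt (τ : Type*) [Finite τ] (m : ℕ) :
    Finite {a : τ →₀ ℕ // a.degree < m} :=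
  Set.Finite.to_subtype (s := {a : τ →₀ ℕ | a.degree < m}) <|
    (Finsupp.finite_of_degree_le (σ := τ) m).subset fun a (h : a.degree < m) => h.le

/-- Hockey-stick summation over the degrees. For `m = 0` and empty `τ` the truncated binomial would
be `1` instead of `0`. -/
theorem card_degree_lt (τ : Type*) [Fintype τ] {m : ℕ} (hm : 1 ≤ m) :
    Nat.card {a : τ →₀ ℕ // a.degree < m} =
      (m + Fintype.card τ - 1).choose (Fintype.card τ) := by
  classical
  have h : ∀ a : τ →₀ ℕ, a ∈ (Finset.range m).biUnion
      (fun k => Finset.finsuppAntidiag (Finset.univ : Finset τ) k) ↔ a.degree < m := by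
    intro a
    simp [Finset.mem_finsuppAntidiag, Finsupp.degree_eq_sum]
  rw [← Nat.card_congr (Equiv.subtypeEquivRight h), Nat.card_eq_fintype_card,
    Fintype.card_coe, Finset.card_biUnion]
  · simp only [Finset.card_finsuppAntidiag_nat_eq_choose, Finset.card_univ]
    obtain ⟨m, rfl⟩ : ∃ k, m = k + 1 := ⟨m - 1, by omega⟩
    cases hn : Fintype.card τ with
    | zero => simp [Finset.sum_range_succ']
    | succ n =>
      rw [show m + 1 + (n + 1) - 1 = m + n + 1 by omega, ← Nat.sum_range_add_choose]
      refine Finset.sum_congr rfl fun k _ => ?_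
      rw [show n + 1 + k - 1 = k + n by omega, Nat.choose_symm_add]
  · intro k _ l _ hkl
    refine Finset.disjoint_left.2 fun a ha hb => hkl ?_
    rw [Finset.mem_finsuppAntidiag] at ha hb
    rw [← ha.1, ← hb.1]

variable {K : Type*} [Field K] {σ : Type*} {ι : Type*}

theorem nonneg_of_mem_independentDegrees [Fintype σ] [Fintype ι] [Nonempty ι]
    {P : ι → ℙ K (σ → K)} {m : ι → ℕ} (hm : ∀ i, 1 ≤ m i) {j : ℤ}
    (hj : j ∈ independentDegrees P m) : 0 ≤ j := by
  cases j with
  | ofNat j => exact Int.natCast_nonneg j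
  | negSucc j =>
    have h : 0 = fatPointDegree σ m := hj
    have i := Classical.arbitrary ι
    have := (Finset.sum_eq_zero_iff.1 h.symm) i (Finset.mem_univ i)
    rw [Nat.choose_eq_zero_iff] at this
    have := hm i
    omega

theorem isLeast_regularityIndex [Fintype σ] [Fintype ι] [Nonempty ι]
    {P : ι → ℙ K (σ → K)} {m : ι → ℕ} (hm : ∀ i, 1 ≤ m i)
    (h : (independentDegrees P m).Nonempty) :
    IsLeast (independentDegrees P m) (regularityIndex P m) := by
  have hb : BddBelow (independentDegrees P m) :=
    ⟨0, fun _ hj => nonneg_of_mem_independentDegrees hm hj⟩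
  exact ⟨Int.csInf_mem h hb, fun _ hj => csInf_le hb hj⟩

variable [DecidableEq σ]

/-- Forms of degree `j` take arbitrary prescribed jets of orders `m i` at the points `w i`,
computed in the affine charts `x_{c i} = 1`. -/
def SurjectiveOnJets (w : ι → σ → K) (c : ι → σ) (m : ι → ℕ) (j : ℕ) : Prop :=
  ∀ g : ∀ i, MvPolynomial {k // k ≠ c i} K, ∃ f : MvPolynomial σ K, f.IsHomogeneous j ∧
    ∀ i, chart (w i) (c i) f - g i ∈ idealOfVars {k // k ≠ c i} K ^ m i

/-- The coefficients of order less than `m i` of forms of degree `j` at the points `w i`. -/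
def jetMap (w : ι → σ → K) (c : ι → σ) (m : ι → ℕ) (j : ℕ) :
    homogeneousSubmodule σ K j →ₗ[K]
      ∀ i, {a : {k // k ≠ c i} →₀ ℕ // a.degree < m i} → K :=
  LinearMap.pi fun i => LinearMap.pi fun a =>
    lcoeff K a.1 ∘ₗ (chart (w i) (c i)).toLinearMap ∘ₗ Submodule.subtype _

theorem jetMap_apply (w : ι → σ → K) (c : ι → σ) (m : ι → ℕ) (j : ℕ)
    (f : homogeneousSubmodule σ K j) (i : ι) (a : {a : {k // k ≠ c i} →₀ ℕ // a.degree < m i}) :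
    jetMap w c m j f i a = coeff a.1 (chart (w i) (c i) f.1) := rfl

theorem surjective_jetMap_iff [Finite σ] (w : ι → σ → K) (c : ι → σ) (m : ι → ℕ) (j : ℕ) :
    Function.Surjective (jetMap w c m j) ↔ SurjectiveOnJets w c m j := by
  simp only [SurjectiveOnJets, mem_pow_idealOfVars_iff', coeff_sub, sub_eq_zero]
  constructor
  · intro h g
    obtain ⟨f, hf⟩ := h fun i a => coeff a.1 (g i)
    refine ⟨f.1, f.2, fun i a ha => ?_⟩
    exact congrFun (congrFun hf i) ⟨a, ha⟩
  · intro h y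
    have hfin : ∀ i, Finite {a : {k // k ≠ c i} →₀ ℕ // a.degree < m i} :=
      fun i => finite_degree_lt _ _
    have hg : ∀ i, ∃ g : MvPolynomial {k // k ≠ c i} K, ∀ a, coeff a.1 g = y i a := by
      intro i
      have := Fintype.ofFinite {a : {k // k ≠ c i} →₀ ℕ // a.degree < m i}
      refine ⟨∑ a, monomial a.1 (y i a), fun a => ?_⟩
      rw [coeff_sum, Finset.sum_eq_single a]
      · simp
      · intro b _ hb
        rw [coeff_monomial, if_neg fun h => hb (Subtype.ext h)]
      · simp
    choose g hg using hg
    obtain ⟨f, hf, hfg⟩ := h g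
    refine ⟨⟨f, hf⟩, ?_⟩
    funext i a
    rw [jetMap_apply, hfg i a.1 a.2, hg]

theorem ker_jetMap [Fintype σ] {w : ι → σ → K} (hw : ∀ i, w i ≠ 0) {c : ι → σ}
    (hc : ∀ i, w i (c i) = 1) (m : ι → ℕ) (j : ℕ) :
    LinearMap.ker (jetMap w c m j) =
      ((fatPointIdeal (fun i => Projectivization.mk K (w i) (hw i)) m).restrictScalars
        K).submoduleOf (homogeneousSubmodule σ K j) := by
  ext f
  rw [LinearMap.mem_ker, Submodule.submoduleOf, Submodule.mem_comap,
    Submodule.restrictScalars_mem, fatPointIdeal, Submodule.mem_iInf, Submodule.subtype_apply]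
  simp only [funext_iff, jetMap_apply, Pi.zero_apply, Subtype.forall,
    fun i => mem_pow_pointIdeal_iff (hw i) (hc i) (m := m i) f.2, mem_pow_idealOfVars_iff']

theorem fatPointDegree_eq_finrank [Fintype σ] [Fintype ι] (c : ι → σ) {m : ι → ℕ}
    (hm : ∀ i, 1 ≤ m i) :
    Module.finrank K (∀ i, {a : {k // k ≠ c i} →₀ ℕ // a.degree < m i} → K) =
      fatPointDegree σ m := by
  have hfin : ∀ i, Finite {a : {k // k ≠ c i} →₀ ℕ // a.degree < m i} :=
    fun i => finite_degree_lt _ _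
  rw [Module.finrank_pi_fintype, fatPointDegree]
  refine Finset.sum_congr rfl fun i _ => ?_
  have := Fintype.ofFinite {a : {k // k ≠ c i} →₀ ℕ // a.degree < m i}
  rw [Module.finrank_fintype_fun_eq_card, ← Nat.card_eq_fintype_card, card_degree_lt _ (hm i)]
  simp [projDim, Fintype.card_subtype_compl]

/-- The Hilbert function is the rank of `jetMap`, whose kernel is the degree `j` part of the ideal,
and `deg X` is the dimension of its target. -/
theorem natCast_mem_independentDegrees_iff [Fintype σ] [Fintype ι] {w : ι → σ → K}
    (hw : ∀ i, w i ≠ 0) {c : ι → σ} (hc : ∀ i, w i (c i) = 1) {m : ι → ℕ} (hm : ∀ i, 1 ≤ m i)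
    (j : ℕ) :
    (j : ℤ) ∈ independentDegrees (fun i => Projectivization.mk K (w i) (hw i)) m ↔
      SurjectiveOnJets w c m j := by
  have hfin : ∀ i, Finite {a : {k // k ≠ c i} →₀ ℕ // a.degree < m i} :=
    fun i => finite_degree_lt _ _
  rw [← surjective_jetMap_iff]
  change Module.finrank K (_ ⧸ _) = _ ↔ _
  rw [← ker_jetMap hw hc, (jetMap w c m j).quotKerEquivRange.finrank_eq,
    ← fatPointDegree_eq_finrank (K := K) c hm, ← LinearMap.range_eq_top]
  exact ⟨Submodule.eq_top_of_finrank_eq, fun h => by rw [h, finrank_top]⟩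

end

/-! ### Unions of hyperplanes and successive approximation of jets. -/

section

variable {K : Type*} [Field K] {σ : Type*}

/-- If every set of at most `N` of the points `w k` can be separated by a hyperplane from any
other one, then points with multiplicities `μ k ≤ t` of sum at most `N * t` lie on a union of `t`
hyperplanes that avoids a given other point. -/
theorem exists_form_of_separated {ι : Type*} {w : ι → σ → K} {N : ℕ} {i : ι}
    (sep : ∀ B : Finset ι, i ∉ B → B.card ≤ N → ∃ l : MvPolynomial σ K,
      l.IsHomogeneous 1 ∧ (∀ k ∈ B, eval (w k) l = 0) ∧ eval (w i) l ≠ 0)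
    (t : ℕ) (μ : ι → ℕ) {A : Finset ι} (hi : i ∉ A) (hμ : ∀ k ∈ A, μ k ≤ t)
    (hsum : ∑ k ∈ A, μ k ≤ N * t) :
    ∃ G : MvPolynomial σ K, G.IsHomogeneous t ∧ eval (w i) G ≠ 0 ∧
      ∀ k ∈ A, G ∈ RingHom.ker (eval (w k)) ^ μ k := by
  classical
  induction t generalizing μ with
  | zero =>
    refine ⟨1, isHomogeneous_one _ _, by simp, fun k hk => ?_⟩
    simp [Nat.le_zero.1 (hμ k hk)]
  | succ t ih =>
    have hTS : A.filter (fun k => μ k = t + 1) ⊆ A.filter (fun k => 0 < μ k) := by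
      intro k
      simp only [Finset.mem_filter]
      exact fun h => ⟨h.1, by omega⟩
    have hT : (A.filter (fun k => μ k = t + 1)).card ≤ N := by
      have h1 : (A.filter (fun k => μ k = t + 1)).card * (t + 1) ≤ ∑ k ∈ A, μ k := by
        rw [← smul_eq_mul, ← Finset.sum_const]
        refine (Finset.sum_le_sum fun k hk => (Finset.mem_filter.1 hk).2.ge).trans
          (Finset.sum_le_sum_of_subset (Finset.filter_subset _ _))
      exact Nat.le_of_mul_le_mul_right (h1.trans hsum) (Nat.succ_pos t)
    -- The next hyperplane passes through all points of maximal multiplicity `t + 1`, and then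
    -- through as many further points of positive multiplicity as `N` allows.
    obtain ⟨B, hTB, hBS, hB⟩ := Finset.exists_subsuperset_card_eq hTS
      (le_min hT (Finset.card_le_card hTS)) (min_le_right _ _)
    have hBA : B ⊆ A := hBS.trans (Finset.filter_subset _ _)
    obtain ⟨l, hl1, hl0, hli⟩ := sep B (fun h => hi (hBA h)) (hB.le.trans (min_le_left _ _))
    have hpos : ∀ k ∈ B, 0 < μ k := fun k hk => (Finset.mem_filter.1 (hBS hk)).2
    have hle : ∀ k ∈ A, (if k ∈ B then μ k - 1 else μ k) ≤ t := by
      intro k hk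
      have h1 := hμ k hk
      split_ifs with h
      · omega
      · have : μ k ≠ t + 1 := fun h2 => h (hTB (Finset.mem_filter.2 ⟨hk, h2⟩))
        omega
    obtain ⟨G, hG, hGi, hGk⟩ := ih (fun k => if k ∈ B then μ k - 1 else μ k) hle (by
      -- Either the sum drops by exactly `N`, or `B` is the whole support and its at most `N` points
      -- keep multiplicity at most `t`.
      rcases le_total N (A.filter (fun k => 0 < μ k)).card with h | h
      · rw [min_eq_left h] at hB
        have h1 : ∑ k ∈ A, (if k ∈ B then μ k - 1 else μ k) + ∑ k ∈ A, (if k ∈ B then 1 else 0) =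
            ∑ k ∈ A, μ k := by
          rw [← Finset.sum_add_distrib]
          refine Finset.sum_congr rfl fun k _ => ?_
          split_ifs with hk
          · have := hpos k hk
            omega
          · rfl
        rw [Finset.sum_boole, Finset.filter_mem_eq_inter, Finset.inter_eq_right.2 hBA, hB] at h1
        rw [mul_add, mul_one] at hsum
        simp only [Nat.cast_id] at h1
        omega
      · rw [min_eq_right h] at hB
        have hBS' := Finset.eq_of_subset_of_card_le hBS hB.ge
        calc ∑ k ∈ A, (if k ∈ B then μ k - 1 else μ k)
            = ∑ k ∈ B, (if k ∈ B then μ k - 1 else μ k) := by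
              refine (Finset.sum_subset hBA fun k hk hkB => ?_).symm
              rw [if_neg hkB]
              by_contra h0
              exact hkB (hBS' ▸ Finset.mem_filter.2 ⟨hk, Nat.pos_of_ne_zero h0⟩)
          _ ≤ B.card • t := Finset.sum_le_card_nsmul _ _ _ fun k hk => hle k (hBA hk)
          _ ≤ N * t := by
              rw [smul_eq_mul, hB]
              exact Nat.mul_le_mul_right t h)
    refine ⟨G * l, hG.mul hl1, by simp [hGi, hli], fun k hk => ?_⟩
    have h1 := hGk k hk
    split_ifs at h1 with h
    · have h2 : μ k = (μ k - 1) + 1 := by have := hpos k h; omega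
      rw [h2, pow_succ]
      exact Ideal.mul_mem_mul h1 (hl0 k h)
    · exact Ideal.mul_mem_right _ _ h1

variable [DecidableEq σ]

/-- The inhomogeneous maximal ideal of the vector `w` suffices to bound vanishing orders from below,
and membership in it is just a zero value. -/
theorem chart_mem_pow_of_mem_ker_pow {w : σ → K} {c : σ} (hc : w c = 1) {m : ℕ}
    {f : MvPolynomial σ K} (hf : f ∈ RingHom.ker (eval w) ^ m) :
    chart w c f ∈ idealOfVars {k // k ≠ c} K ^ m :=
  Ideal.le_comap_pow (chart w c) m
    (Ideal.pow_right_mono (fun g hg => (chart_mem_idealOfVars_iff hc g).2 hg) m hf)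

open scoped Pointwise in
/-- Forms of degree `t` in the ideal `J` take arbitrary jets of order `m` at a point `w`, if they
take all products of fewer than `m` elements of `L` as leading forms at `w`, where `L` consists of
linear forms that generate the maximal ideal of `w`. -/
theorem exists_jet_of_leading_forms {w : σ → K} {c : σ} (hc : w c = 1)
    {J : Ideal (MvPolynomial σ K)} {m t : ℕ} {L : Set (MvPolynomial σ K)}
    (hL1 : ∀ l ∈ L, l.IsHomogeneous 1) (hL0 : ∀ l ∈ L, eval w l = 0)
    (hspan : idealOfVars {k // k ≠ c} K ≤ Ideal.span (chart w c '' L))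
    (hG : ∀ k < m, ∀ e : Fin k → MvPolynomial σ K, (∀ q, e q ∈ L) →
      ∃ G : MvPolynomial σ K, ∃ r, r + k = t ∧ G.IsHomogeneous r ∧ eval w G ≠ 0 ∧
        G * ∏ q, e q ∈ J)
    (g : MvPolynomial {k // k ≠ c} K) :
    ∃ f ∈ J, f.IsHomogeneous t ∧ chart w c f - g ∈ idealOfVars {k // k ≠ c} K ^ m := by
  set M := idealOfVars {k // k ≠ c} K with hM
  have hL0' : ∀ l ∈ L, chart w c l ∈ M := fun l hl =>
    (chart_mem_idealOfVars_iff hc l).2 (hL0 l hl)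
  have key : ∀ k < m, ∀ h ∈ M ^ k, ∃ f ∈ J, f.IsHomogeneous t ∧ chart w c f - h ∈ M ^ (k + 1) := by
    -- `M ^ k` is generated by `k`-fold products of charts of `L`. Membership in `M ^ k` is carried
    -- along because the scalar step needs it.
    intro k hk h hh
    have hh' : h ∈ Ideal.span ((chart w c '' L) ^ k) := by
      rw [Ideal.span, ← Submodule.span_pow]
      exact Ideal.pow_right_mono hspan k hh
    suffices h ∈ M ^ k ∧ ∃ f ∈ J, f.IsHomogeneous t ∧ chart w c f - h ∈ M ^ (k + 1) from this.2
    refine Submodule.span_induction ?_ ?_ ?_ ?_ hh'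
    · intro x hx
      obtain ⟨u, rfl⟩ := Set.mem_pow.1 hx
      choose e he heu using fun q => (u q).2
      simp only [← heu, List.prod_ofFn]
      have hmem : ∏ q, chart w c (e q) ∈ M ^ k := by
        have := Ideal.prod_mem_prod (s := Finset.univ) (I := fun _ : Fin k => M)
          (x := fun q => chart w c (e q)) fun q _ => hL0' _ (he q)
        simpa using this
      refine ⟨hmem, ?_⟩
      obtain ⟨G, r, rfl, hGr, hGw, hGJ⟩ := hG k hk e he
      refine ⟨C (eval w G)⁻¹ * (G * ∏ q, e q), J.mul_mem_left _ hGJ, ?_, ?_⟩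
      · have he1 : (∏ q, e q).IsHomogeneous k := by
          simpa using IsHomogeneous.prod Finset.univ e (fun _ => 1) fun q _ => hL1 _ (he q)
        exact (hGr.mul he1).C_mul _
      · have h1 : C (eval w G)⁻¹ * chart w c G - 1 ∈ M := by
          rw [mem_idealOfVars_iff]
          simp [constantCoeff_chart hc, hGw]
        rw [pow_succ']
        convert Ideal.mul_mem_mul h1 hmem using 1
        rw [map_mul, map_mul, chart_C, map_prod]
        ring
    · exact ⟨zero_mem _, 0, zero_mem _, isHomogeneous_zero _ _ _, by simp⟩
    · rintro x y - - ⟨hx, f, hfJ, hft, hf⟩ ⟨hy, f', hfJ', hft', hf'⟩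
      refine ⟨add_mem hx hy, f + f', add_mem hfJ hfJ', hft.add hft', ?_⟩
      convert add_mem hf hf' using 1
      rw [map_add]
      ring
    -- Modulo `M ^ (k + 1)`, only the constant term of `a` acts on `x ∈ M ^ k`.
    · rintro a x - ⟨hx, f, hfJ, hft, hf⟩
      refine ⟨Ideal.mul_mem_left _ _ hx, C (constantCoeff a) * f, J.mul_mem_left _ hfJ,
        hft.C_mul _, ?_⟩
      have h1 : a - C (constantCoeff a) ∈ M := by
        rw [mem_idealOfVars_iff]
        simp
      have h2 := Ideal.mul_mem_mul h1 hx
      rw [← pow_succ'] at h2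
      convert sub_mem (Ideal.mul_mem_left _ (C (constantCoeff a)) hf) h2 using 1
      rw [map_mul, chart_C, smul_eq_mul]
      ring
  suffices ∀ k ≤ m, ∃ f ∈ J, f.IsHomogeneous t ∧ chart w c f - g ∈ M ^ k from this m le_rfl
  intro k hk
  induction k with
  | zero => exact ⟨0, zero_mem _, isHomogeneous_zero _ _ _, by simp⟩
  | succ k ih =>
    obtain ⟨f, hfJ, hft, hf⟩ := ih (by omega)
    obtain ⟨f', hfJ', hft', hf'⟩ := key k (by omega) _ hf
    refine ⟨f - f', sub_mem hfJ hfJ', hft.sub hft', ?_⟩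
    convert neg_mem hf' using 1
    rw [map_sub]
    ring

variable {ι : Type*}

/-- The jet at the new point is corrected by a form that vanishes to order `m k` at each old point.
-/
theorem exists_jets_insert [DecidableEq ι] {w : ι → σ → K} {c : ι → σ}
    (hc : ∀ i, w i (c i) = 1) {m : ι → ℕ} {t : ℕ} {A : Finset ι} {i : ι}
    (g : ∀ i, MvPolynomial {k // k ≠ c i} K)
    (hA : ∃ f : MvPolynomial σ K, f.IsHomogeneous t ∧
      ∀ k ∈ A, chart (w k) (c k) f - g k ∈ idealOfVars {q // q ≠ c k} K ^ m k)
    (hi : ∀ g : MvPolynomial {k // k ≠ c i} K,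
      ∃ f ∈ ⨅ k ∈ A, RingHom.ker (eval (w k)) ^ m k, f.IsHomogeneous t ∧
        chart (w i) (c i) f - g ∈ idealOfVars {k // k ≠ c i} K ^ m i) :
    ∃ f : MvPolynomial σ K, f.IsHomogeneous t ∧
      ∀ k ∈ insert i A, chart (w k) (c k) f - g k ∈ idealOfVars {q // q ≠ c k} K ^ m k := by
  obtain ⟨f, hft, hf⟩ := hA
  obtain ⟨f', hfJ', hft', hf'⟩ := hi (g i - chart (w i) (c i) f)
  refine ⟨f + f', hft.add hft', fun k hk => ?_⟩
  rcases Finset.mem_insert.1 hk with rfl | hk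
  · convert hf' using 1
    rw [map_add]
    ring
  · simp only [Submodule.mem_iInf] at hfJ'
    convert add_mem (hf k hk) (chart_mem_pow_of_mem_ker_pow (hc k) (hfJ' k hk)) using 1
    rw [map_add]
    ring

theorem idealOfVars_le_span_chart (w : σ → K) (c : σ) {L : Set (MvPolynomial σ K)}
    (h : ∀ k ≠ c, chartForm w c k ∈ Ideal.span L) :
    idealOfVars {k // k ≠ c} K ≤ Ideal.span (chart w c '' L) := by
  refine Ideal.span_le.2 ?_
  rintro _ ⟨⟨k, hk⟩, rfl⟩
  have := Ideal.mem_map_of_mem (chart w c) (h k hk)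
  rwa [Ideal.map_span, chart_chartForm w hk] at this

end

/-! ### Interpolation at points in general position. -/

section

variable {K : Type*} [Field K] {σ : Type*} {ι : Type*}

/-- The linear forms that vanish at `v` and at all but at most one of the points `w k`, `k ∈ B`. -/
def adaptedForms [DecidableEq K] (v : σ → K) (w : ι → σ → K) (B : Finset ι) :
    Set (MvPolynomial σ K) :=
  {l | l.IsHomogeneous 1 ∧ eval v l = 0 ∧ (B.filter fun k => eval (w k) l ≠ 0).card ≤ 1}

theorem mem_span_adaptedForms [DecidableEq K] {v : σ → K} {w : ι → σ → K} {B : Finset ι}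
    (sep : ∀ b ∈ B, ∃ l : MvPolynomial σ K, l.IsHomogeneous 1 ∧ eval v l = 0 ∧
      (∀ k ∈ B, k ≠ b → eval (w k) l = 0) ∧ eval (w b) l ≠ 0)
    {l : MvPolynomial σ K} (hl : l.IsHomogeneous 1) (hv : eval v l = 0) :
    l ∈ Ideal.span (adaptedForms v w B) := by
  classical
  choose! d hd1 hdv hd0 hdb using sep
  have hmem : ∀ b ∈ B, d b ∈ adaptedForms v w B := by
    intro b hb
    refine ⟨hd1 b hb, hdv b hb, Finset.card_le_one.2 fun x hx y hy => ?_⟩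
    have h1 : ∀ z ∈ B.filter fun k => eval (w k) (d b) ≠ 0, z = b := by
      intro z hz
      by_contra hzb
      exact (Finset.mem_filter.1 hz).2 (hd0 b hb z (Finset.mem_filter.1 hz).1 hzb)
    rw [h1 x hx, h1 y hy]
  -- Lagrange interpolation: `r` agrees with `l` on `B`, so `l - r` vanishes at all of `B`.
  set r := ∑ b ∈ B, C (eval (w b) l / eval (w b) (d b)) * d b with hr
  have hrest : l - r ∈ adaptedForms v w B := by
    refine ⟨hl.sub (IsHomogeneous.sum _ _ _ fun b hb => (hd1 b hb).C_mul _), ?_, ?_⟩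
    · rw [map_sub, hv, hr, map_sum, Finset.sum_eq_zero, sub_zero]
      intro b hb
      simp [hdv b hb]
    · rw [Finset.filter_false_of_mem]
      · simp
      · intro k hk
        rw [not_not, map_sub, hr, map_sum, Finset.sum_eq_single_of_mem k hk]
        · simp [hdb k hk]
        · intro b hb hbk
          simp [hd0 b hb k hk hbk.symm]
  rw [← sub_add_cancel l r]
  exact add_mem (Ideal.subset_span hrest)
    (sum_mem fun b hb => Ideal.mul_mem_left _ _ (Ideal.subset_span (hmem b hb)))

theorem prod_mem_ker_eval_pow [DecidableEq K] {k : ℕ} {w : σ → K}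
    (e : Fin k → MvPolynomial σ K) :
    ∏ q, e q ∈ RingHom.ker (eval w) ^ (k - (Finset.univ.filter fun q => eval w (e q) ≠ 0).card) := by
  have h : k - (Finset.univ.filter fun q => eval w (e q) ≠ 0).card =
      ∑ q, if eval w (e q) = 0 then 1 else 0 := by
    have := Finset.card_filter_add_card_filter_not (s := (Finset.univ : Finset (Fin k)))
      (fun q => eval w (e q) = 0)
    rw [Finset.sum_boole, Nat.cast_id]
    rw [Finset.card_univ, Fintype.card_fin] at this
    simp only [ne_eq]
    omega
  rw [h, ← Finset.prod_pow_eq_pow_sum]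
  refine Ideal.prod_mem_prod fun q _ => ?_
  split_ifs with hq
  · rw [pow_one]
    exact hq
  · simp

/-- Double counting: each of the `k` factors is nonzero at no more than one point of `B`. -/
theorem sum_card_filter_adaptedForms_le [DecidableEq K] {v : σ → K} {w : ι → σ → K} {B : Finset ι}
    {k : ℕ} {e : Fin k → MvPolynomial σ K} (he : ∀ q, e q ∈ adaptedForms v w B) :
    ∑ b ∈ B, (Finset.univ.filter fun q => eval (w b) (e q) ≠ 0).card ≤ k := by
  have h := Finset.sum_card_bipartiteAbove_eq_sum_card_bipartiteBelow (s := B)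
    (t := (Finset.univ : Finset (Fin k))) (fun b q => eval (w b) (e q) ≠ 0)
  simp only [Finset.bipartiteAbove, Finset.bipartiteBelow] at h
  rw [h]
  refine (Finset.sum_le_card_nsmul _ _ 1 fun q _ => (he q).2.2).trans ?_
  simp

variable [DecidableEq σ]

/-- The bound of Catalisano, Trung and Valla for fat points in general position. -/
theorem surjectiveOnJets_of_separated [Fintype ι] {w : ι → σ → K} {c : ι → σ}
    (hc : ∀ i, w i (c i) = 1) {m : ι → ℕ} {N t : ℕ}
    (sep : ∀ i, ∀ B : Finset ι, i ∉ B → B.card ≤ N → ∃ l : MvPolynomial σ K,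
      l.IsHomogeneous 1 ∧ (∀ k ∈ B, eval (w k) l = 0) ∧ eval (w i) l ≠ 0)
    (h1 : ∀ i, m i ≤ t + 1) (h2 : ∀ i k, i ≠ k → m i + m k ≤ t + 1)
    (hsum : ∑ i, m i ≤ N * t + 1) :
    SurjectiveOnJets w c m t := by
  classical
  intro g
  suffices ∀ A : Finset ι, ∃ f : MvPolynomial σ K, f.IsHomogeneous t ∧
      ∀ k ∈ A, chart (w k) (c k) f - g k ∈ idealOfVars {q // q ≠ c k} K ^ m k by
    simpa using this Finset.univ
  intro A
  -- The inserted point has the smallest multiplicity, so `k < m i ≤ m b` for `b ∈ A` and the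
  -- subtraction in `μ` below does not truncate.
  induction A using Finset.induction_on_min_value m with
  | empty => exact ⟨0, isHomogeneous_zero _ _ _, by simp⟩
  | insert i A hiA hmin ih =>
    refine exists_jets_insert hc g ih fun g => ?_
    obtain ⟨B, hBA, hB⟩ := Finset.exists_subset_card_eq (min_le_right N A.card)
    have hiB : i ∉ B := fun h => hiA (hBA h)
    have hBN : B.card ≤ N := hB.le.trans (min_le_left _ _)
    have hsepB : ∀ b ∈ B, ∃ l : MvPolynomial σ K, l.IsHomogeneous 1 ∧ eval (w i) l = 0 ∧
        (∀ k ∈ B, k ≠ b → eval (w k) l = 0) ∧ eval (w b) l ≠ 0 := by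
      intro b hb
      obtain ⟨l, hl, hl0, hlb⟩ := sep b (insert i (B.erase b)) (by aesop)
        ((Finset.card_insert_le _ _).trans (by rw [Finset.card_erase_add_one hb]; exact hBN))
      exact ⟨l, hl, hl0 i (Finset.mem_insert_self _ _), fun k hk hkb => hl0 k (by simp [hk, hkb]),
        hlb⟩
    refine exists_jet_of_leading_forms (hc i) (L := adaptedForms (w i) w B)
      (fun l hl => hl.1) (fun l hl => hl.2.1) (idealOfVars_le_span_chart _ _ fun k _ =>
        mem_span_adaptedForms hsepB (isHomogeneous_chartForm _ _ _)
          (by simp [eval_chartForm, hc i])) ?_ g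
    intro k hk e he
    obtain ⟨r, rfl⟩ : ∃ r, t = r + k := ⟨t - k, by have := h1 i; omega⟩
    -- At `b ∈ B` the product of the `e q` already vanishes to order `k - n b`; `μ b` is what `G`
    -- still has to supply.
    set n : ι → ℕ := fun b => (Finset.univ.filter fun q => eval (w b) (e q) ≠ 0).card with hn
    have hnk : ∀ b, n b ≤ k := fun b =>
      (Finset.card_filter_le _ _).trans (by simp)
    have hnsum : ∑ b ∈ B, n b ≤ k := sum_card_filter_adaptedForms_le he
    set μ : ι → ℕ := fun b => if b ∈ B then m b + n b - k else m b with hμ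
    have hμr : ∀ b ∈ A, μ b ≤ r := by
      intro b hb
      have hib : i ≠ b := fun h => hiA (h ▸ hb)
      have h3 := h2 i b hib
      have h4 := hnk b
      simp only [hμ]
      split_ifs <;> omega
    -- If `B` has `N` points, the sum is at most `(N * t + 1 - m i) - N * k + k`, and `k + 1 ≤ m i`
    -- absorbs the extra `1`.
    have hμsum : ∑ b ∈ A, μ b ≤ N * r := by
      rcases le_total N A.card with h | h
      · rw [min_eq_left h] at hB
        have h3 : ∑ b ∈ A, μ b + ∑ b ∈ A, (if b ∈ B then k else 0) =
            ∑ b ∈ A, m b + ∑ b ∈ A, (if b ∈ B then n b else 0) := by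
          rw [← Finset.sum_add_distrib, ← Finset.sum_add_distrib]
          refine Finset.sum_congr rfl fun b hb => ?_
          have := hmin b hb
          simp only [hμ]
          split_ifs <;> omega
        rw [Finset.sum_ite_mem, Finset.sum_ite_mem, Finset.inter_eq_right.2 hBA, Finset.sum_const,
          hB, smul_eq_mul] at h3
        have h4 : ∑ b ∈ insert i A, m b ≤ ∑ b, m b :=
          Finset.sum_le_sum_of_subset (Finset.subset_univ _)
        rw [Finset.sum_insert hiA] at h4
        rw [mul_add] at hsum
        omega
      · rw [min_eq_right h] at hB
        calc ∑ b ∈ A, μ b ≤ A.card • r := Finset.sum_le_card_nsmul _ _ _ hμr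
          _ ≤ N * r := Nat.mul_le_mul_right r h
    obtain ⟨G, hG, hGi, hGk⟩ := exists_form_of_separated (sep i) r μ hiA hμr hμsum
    refine ⟨G, r, rfl, hG, hGi, ?_⟩
    simp only [Submodule.mem_iInf]
    intro b hb
    have h3 := hGk b hb
    by_cases hbB : b ∈ B
    · have h4 := Ideal.mul_mem_mul h3 (prod_mem_ker_eval_pow (w := w b) e)
      rw [← pow_add] at h4
      refine Ideal.pow_le_pow_right ?_ h4
      change m b ≤ μ b + (k - n b)
      have h5 := hnk b
      simp only [hμ, if_pos hbB]
      omega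
    · simp only [hμ, if_neg hbB] at h3
      exact Ideal.mul_mem_right _ _ h3

end

/-! ### Pulling back along the Veronese embedding. -/

section

variable {K : Type*} [Field K] {σ : Type*} [Fintype σ] [DecidableEq σ]

/-- The substitution `y_a ↦ x ^ a` that corresponds to the Veronese embedding. -/
def veronesePullback (K : Type*) [Field K] (σ : Type*) [Fintype σ] [DecidableEq σ] (d : ℕ) :
    MvPolynomial (Exponents σ d) K →ₐ[K] MvPolynomial σ K :=
  aeval fun a => ∏ i, X i ^ (a : σ → ℕ) i

theorem isHomogeneous_veronesePullback {d j : ℕ} {F : MvPolynomial (Exponents σ d) K}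
    (hF : F.IsHomogeneous j) : (veronesePullback K σ d F).IsHomogeneous (d * j) := by
  refine hF.aeval (S := K) _ (n := d) fun a => ?_
  have ha : ∑ i, (a : σ → ℕ) i = d := (Finset.mem_piAntidiag.mp a.2).1
  have := IsHomogeneous.prod Finset.univ (fun i => (X i : MvPolynomial σ K) ^ (a : σ → ℕ) i)
    (fun i => (a : σ → ℕ) i) fun i _ => isHomogeneous_X_pow _ _
  rwa [ha] at this

theorem eval_veronesePullback (d : ℕ) (v : σ → K) (F : MvPolynomial (Exponents σ d) K) :
    eval v (veronesePullback K σ d F) = eval (veroneseVec d v) F := by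
  suffices h : (aeval v).comp (veronesePullback K σ d) = aeval (R := K) (veroneseVec d v) from
    DFunLike.congr_fun h F
  ext1 a
  simp [veronesePullback, veroneseVec]

/-- The exponent vector of `x_c ^ d`. -/
def powExponent (d : ℕ) (c : σ) : Exponents σ d :=
  ⟨Pi.single c d, by simp [Finset.mem_piAntidiag]⟩

theorem veroneseVec_powExponent (d : ℕ) {c : σ} {v : σ → K} (hc : v c = 1) :
    veroneseVec d v (powExponent d c) = 1 := by
  refine Finset.prod_eq_one fun k _ => ?_
  by_cases h : k = c
  · subst h; simp [hc]
  · simp [powExponent, h]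

/-- The Veronese embedding in the affine charts at `v` and `veroneseVec d v`. -/
def chartVeronesePullback (d : ℕ) (v : σ → K) (c : σ) :
    MvPolynomial {a // a ≠ powExponent d c} K →ₐ[K] MvPolynomial {k // k ≠ c} K :=
  aeval fun a => chart v c (veronesePullback K σ d (X a.1)) - C (veroneseVec d v a.1)

theorem chartVeronesePullback_chart (d : ℕ) (v : σ → K) (c : σ)
    (F : MvPolynomial (Exponents σ d) K) :
    chartVeronesePullback d v c (chart (veroneseVec d v) (powExponent d c) F) =
      chart v c (veronesePullback K σ d F) := by
  suffices h : (chartVeronesePullback d v c).comp (chart (veroneseVec d v) (powExponent d c)) =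
      (chart v c).comp (veronesePullback K σ d) from DFunLike.congr_fun h F
  ext1 a
  by_cases h : a = powExponent d c
  · subst h
    simp only [AlgHom.comp_apply, chart_X_self, map_one]
    rw [veronesePullback, aeval_X, map_prod]
    refine (Finset.prod_eq_one fun k _ => ?_).symm
    by_cases hk : k = c
    · subst hk; simp
    · simp [powExponent, hk]
  · simp only [AlgHom.comp_apply, chart_X_of_ne _ h, map_add]
    simp [chartVeronesePullback]

theorem chartVeronesePullback_mem_pow (d : ℕ) {v : σ → K} {c : σ} (hc : v c = 1) {m : ℕ}
    {F : MvPolynomial {a // a ≠ powExponent d c} K} (hF : F ∈ idealOfVars _ K ^ m) :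
    chartVeronesePullback d v c F ∈ idealOfVars {k // k ≠ c} K ^ m := by
  refine Ideal.le_comap_pow (chartVeronesePullback d v c) m (Ideal.pow_right_mono ?_ m hF)
  refine Ideal.span_le.2 ?_
  rintro _ ⟨a, rfl⟩
  change chartVeronesePullback d v c (X a) ∈ idealOfVars {k // k ≠ c} K
  rw [mem_idealOfVars_iff, chartVeronesePullback, aeval_X, map_sub, constantCoeff_chart hc,
    eval_veronesePullback]
  simp

/-- The Veronese coordinate of `x_c ^ (d - 1) * x_k` restricts to the chart coordinate of `x_k`, so
the embedding is a closed immersion on the chart. -/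
theorem surjective_chartVeronesePullback {d : ℕ} (hd : 1 ≤ d) {v : σ → K} {c : σ}
    (hc : v c = 1) : Function.Surjective (chartVeronesePullback d v c) := by
  rw [← AlgHom.range_eq_top, eq_top_iff, ← adjoin_range_X, Algebra.adjoin_le_iff]
  rintro _ ⟨⟨k, hk⟩, rfl⟩
  have hmem : (Pi.single c (d - 1) + Pi.single k 1 : σ → ℕ) ∈
      Finset.piAntidiag (Finset.univ : Finset σ) d := by
    simp [Finset.mem_piAntidiag, Finset.sum_add_distrib]
    omega
  have hne : (⟨_, hmem⟩ : Exponents σ d) ≠ powExponent d c := by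
    intro h
    have := congrFun (congrArg Subtype.val h) k
    simp [powExponent, hk] at this
  refine ⟨X ⟨⟨_, hmem⟩, hne⟩, ?_⟩
  have h1 : veronesePullback K σ d (X ⟨_, hmem⟩) = X c ^ (d - 1) * X k := by
    simp only [veronesePullback, aeval_X, Pi.add_apply, pow_add, Finset.prod_mul_distrib]
    congr 1
    · rw [Finset.prod_eq_single c] <;> simp +contextual
    · rw [Finset.prod_eq_single k] <;> simp +contextual
  change chartVeronesePullback d v c (X ⟨⟨_, hmem⟩, hne⟩) = X ⟨k, hk⟩
  rw [chartVeronesePullback, aeval_X]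
  dsimp only
  have h2 : veroneseVec d v ⟨_, hmem⟩ = v k := by
    have h3 := eval_veronesePullback d v (X ⟨_, hmem⟩)
    rw [h1] at h3
    simpa [hc] using h3.symm
  rw [h1, h2, map_mul, map_pow, chart_X_self, chart_X_of_ne v hk]
  simp

theorem SurjectiveOnJets.of_veronese {ι : Type*} {d : ℕ} (hd : 1 ≤ d) {w : ι → σ → K} {c : ι → σ}
    (hc : ∀ i, w i (c i) = 1) {m : ι → ℕ} {j : ℕ}
    (h : SurjectiveOnJets (fun i => veroneseVec d (w i)) (fun i => powExponent d (c i)) m j) :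
    SurjectiveOnJets w c m (d * j) := by
  intro g
  choose g' hg' using fun i => surjective_chartVeronesePullback hd (hc i) (g i)
  obtain ⟨F, hF, hFg⟩ := h g'
  refine ⟨veronesePullback K σ d F, isHomogeneous_veronesePullback hF, fun i => ?_⟩
  have := chartVeronesePullback_mem_pow d (hc i) (hFg i)
  rwa [map_sub, chartVeronesePullback_chart, hg'] at this

theorem exists_veronesePullback_eq {d : ℕ} {f : MvPolynomial σ K}
    (hf : f.IsHomogeneous d) :
    ∃ l : MvPolynomial (Exponents σ d) K, l.IsHomogeneous 1 ∧ veronesePullback K σ d l = f := by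
  have hmem : ∀ b ∈ f.support, (⇑b : σ → ℕ) ∈ Finset.piAntidiag (Finset.univ : Finset σ) d := by
    intro b hb
    simp only [Finset.mem_piAntidiag, Finset.mem_univ, implies_true, and_true]
    rw [← Finsupp.degree_eq_sum]
    by_contra h
    exact (mem_support_iff.1 hb) (hf.coeff_eq_zero h)
  refine ⟨∑ b : f.support, C (coeff b.1 f) * X ⟨_, hmem b.1 b.2⟩,
    IsHomogeneous.sum _ _ _ fun b _ => isHomogeneous_C_mul_X _ _, ?_⟩
  conv_rhs => rw [f.as_sum, ← Finset.sum_coe_sort]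
  rw [map_sum]
  refine Finset.sum_congr rfl fun b _ => ?_
  rw [map_mul, veronesePullback, aeval_X, monomial_eq, Finsupp.prod_fintype _ _ fun k => pow_zero _]
  simp

theorem veronese_mk (d : ℕ) {v : σ → K} (hv : v ≠ 0) :
    veronese d (Projectivization.mk K v hv) =
      Projectivization.mk K (veroneseVec d v) (veroneseVec_ne_zero d hv) := rfl

end

/-! ### Normalized representatives, binary forms and separation on the Veronese variety. -/

section

theorem exists_normalized_rep {K : Type*} [Field K] {σ : Type*} (P : ℙ K (σ → K)) :
    ∃ (w : σ → K) (hw : w ≠ 0) (c : σ), w c = 1 ∧ P = Projectivization.mk K w hw := by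
  obtain ⟨c, hc⟩ := Function.ne_iff.1 P.rep_nonzero
  have hc' : P.rep c ≠ 0 := hc
  refine ⟨(P.rep c)⁻¹ • P.rep, smul_ne_zero (inv_ne_zero hc') P.rep_nonzero, c, by simp [hc'], ?_⟩
  conv_lhs => rw [← P.mk_rep]
  rw [Projectivization.mk_eq_mk_iff']
  exact ⟨P.rep c, by rw [smul_smul, mul_inv_cancel₀ hc', one_smul]⟩

theorem exists_ne_mul_of_mk_ne {K : Type*} [Field K] {σ : Type*} {v w : σ → K} (hv : v ≠ 0)
    (hw : w ≠ 0) (h : Projectivization.mk K v hv ≠ Projectivization.mk K w hw) (c : σ) :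
    ∃ q, v q ≠ w q * v c := by
  by_contra! hq
  refine h ((Projectivization.mk_eq_mk_iff' K v w hv hw).2 ⟨v c, ?_⟩)
  funext q
  rw [hq q, Pi.smul_apply, smul_eq_mul, mul_comm]

theorem finrank_homogeneousSubmodule_le (K : Type*) [Field K] (j : ℕ) :
    Module.finrank K (homogeneousSubmodule (Fin 2) K j) ≤ j + 1 := by
  classical
  set S := (Finset.finsuppAntidiag (Finset.univ : Finset (Fin 2)) j).image
    fun b => (monomial b 1 : MvPolynomial (Fin 2) K)
  have hle : homogeneousSubmodule (Fin 2) K j ≤ Submodule.span K S := by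
    intro f hf
    rw [f.as_sum]
    refine sum_mem fun b hb => ?_
    have hb' : b.degree = j := by
      by_contra h
      exact (mem_support_iff.1 hb) (IsHomogeneous.coeff_eq_zero hf h)
    rw [← mul_one (coeff b f), ← smul_eq_mul, ← smul_monomial]
    refine Submodule.smul_mem _ _ (Submodule.subset_span ?_)
    refine Finset.mem_coe.2 (Finset.mem_image_of_mem _ ?_)
    simpa [Finset.mem_finsuppAntidiag, Finsupp.degree_eq_sum] using hb'
  refine (Submodule.finrank_mono hle).trans ((finrank_span_finset_le_card S).trans
    (Finset.card_image_le.trans ?_))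
  rw [Finset.card_finsuppAntidiag_nat_eq_choose, Finset.card_univ, Fintype.card_fin,
    show 2 + j - 1 = j + 1 by omega, Nat.choose_succ_self_right]

theorem SurjectiveOnJets.sum_le {K : Type*} [Field K] {ι : Type*} [Fintype ι]
    {w : ι → Fin 2 → K} {c : ι → Fin 2} {m : ι → ℕ} (hm : ∀ i, 1 ≤ m i) {j : ℕ}
    (h : SurjectiveOnJets w c m j) : ∑ i, m i ≤ j + 1 := by
  rw [← surjective_jetMap_iff] at h
  have : Module.Finite K (homogeneousSubmodule (Fin 2) K j) :=
    Module.Finite.iff_fg.2 (homogeneousSubmodule_fg _ _ j)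
  have h1 := LinearMap.finrank_le_finrank_of_surjective h
  rw [fatPointDegree_eq_finrank c hm] at h1
  simpa [fatPointDegree, projDim] using h1.trans (finrank_homogeneousSubmodule_le K j)

variable {K : Type*} [Field K] {σ : Type*} [Fintype σ] [DecidableEq σ] {ι : Type*}

/-- On the `d`-th Veronese variety, any `d` points can be separated by a hyperplane from any other
point. -/
theorem exists_linear_form_veronese {d : ℕ} {w : ι → σ → K} {c : ι → σ}
    (hc : ∀ i, w i (c i) = 1) (hw : ∀ i k, i ≠ k → ∃ q, w i q ≠ w k q * w i (c k))
    (i : ι) (B : Finset ι) (hi : i ∉ B) (hB : B.card ≤ d) :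
    ∃ l : MvPolynomial (Exponents σ d) K, l.IsHomogeneous 1 ∧
      (∀ k ∈ B, eval (veroneseVec d (w k)) l = 0) ∧ eval (veroneseVec d (w i)) l ≠ 0 := by
  have : Nonempty σ := ⟨c i⟩
  choose! q hq using hw i
  -- One linear form through each point of `B` missing `w i`, padded to degree `d` by a coordinate
  -- equal to `1` at `w i`.
  have hf : (X (c i) ^ (d - B.card) * ∏ k ∈ B, chartForm (w k) (c k) (q k)).IsHomogeneous d := by
    have h1 := IsHomogeneous.prod B (fun k => chartForm (w k) (c k) (q k)) (fun _ => 1)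
      fun k _ => isHomogeneous_chartForm _ _ _
    have h2 := (isHomogeneous_X_pow (R := K) (c i) (d - B.card)).mul h1
    rwa [Finset.sum_const, smul_eq_mul, mul_one, Nat.sub_add_cancel hB] at h2
  obtain ⟨l, hl, hlf⟩ := exists_veronesePullback_eq hf
  refine ⟨l, hl, fun k hk => ?_, ?_⟩
  · rw [← eval_veronesePullback, hlf, map_mul, map_prod, Finset.prod_eq_zero hk, mul_zero]
    simp [eval_chartForm, hc k]
  · rw [← eval_veronesePullback, hlf]
    simp only [map_mul, map_pow, map_prod, eval_X, hc i, one_pow, one_mul, eval_chartForm]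
    refine Finset.prod_ne_zero_iff.2 fun k hk => sub_ne_zero.2 (hq k ?_)
    rintro rfl
    exact hi hk

theorem surjectiveOnJets_veronese [Fintype ι] {d t : ℕ} {w : ι → σ → K} {c : ι → σ}
    (hc : ∀ i, w i (c i) = 1) (hw : ∀ i k, i ≠ k → ∃ q, w i q ≠ w k q * w i (c k))
    {m : ι → ℕ} (h1 : ∀ i, m i ≤ t + 1) (h2 : ∀ i k, i ≠ k → m i + m k ≤ t + 1)
    (hsum : ∑ i, m i ≤ d * t + 1) :
    SurjectiveOnJets (fun i => veroneseVec d (w i)) (fun i => powExponent d (c i)) m t :=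
  surjectiveOnJets_of_separated (fun i => veroneseVec_powExponent d (hc i))
    (exists_linear_form_veronese hc hw) h1 h2 hsum

end

end FatPoints

end

open FatPoints in
theorem mainTheorem6 (K : Type*) [Field K] (n d s : ℕ) (hd : 1 ≤ d) (hs : 1 ≤ s)
    (P : Fin s → ℙ K (Fin (n + 1) → K)) (hP : Function.Injective P)
    (m : Fin s → ℕ) (hm : ∀ i, 1 ≤ m i) :
    IsLeast (FatPoints.independentDegrees P m) (FatPoints.regularityIndex P m) ∧
    IsLeast (FatPoints.independentDegrees (fun i => FatPoints.veronese d (P i)) m)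
      (FatPoints.regularityIndex (fun i => FatPoints.veronese d (P i)) m) ∧
    ⌈(FatPoints.regularityIndex P m : ℚ) / (d : ℚ)⌉ ≤
      FatPoints.regularityIndex (fun i => FatPoints.veronese d (P i)) m ∧
    (n = 1 → 2 ≤ s →
      (∀ j k : Fin s, j < k →
        (d : ℤ) * ((m j : ℤ) + (m k : ℤ)) ≤ 2 * (d : ℤ) - 2 + ∑ i, (m i : ℤ)) →
      ⌈(FatPoints.regularityIndex P m : ℚ) / (d : ℚ)⌉ =
        FatPoints.regularityIndex (fun i => FatPoints.veronese d (P i)) m ∧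
      FatPoints.regularityIndex (fun i => FatPoints.veronese d (P i)) m =
        ⌈(-1 + ∑ i, (m i : ℚ)) / (d : ℚ)⌉) := by
  have : Nonempty (Fin s) := ⟨⟨0, hs⟩⟩
  choose w hw0 c hc hPw using fun i => exists_normalized_rep (P i)
  obtain rfl : P = fun i => Projectivization.mk K (w i) (hw0 i) := funext hPw
  have hw : ∀ i k, i ≠ k → ∃ q, w i q ≠ w k q * w i (c k) := fun i k hik =>
    exists_ne_mul_of_mk_ne (hw0 i) (hw0 k) (hP.ne hik) (c k)
  simp only [veronese_mk]
  have hX := natCast_mem_independentDegrees_iff hw0 hc hm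
  have hV := natCast_mem_independentDegrees_iff (fun i => veroneseVec_ne_zero d (hw0 i))
    (fun i => veroneseVec_powExponent d (hc i)) hm
  -- The crude degree `∑ m_i` shows that both sets of independent degrees are nonempty.
  have hVsum : SurjectiveOnJets (fun i => veroneseVec d (w i)) (fun i => powExponent d (c i)) m
      (∑ i, m i) := by
    refine surjectiveOnJets_veronese hc hw (fun i => ?_) (fun i k hik => ?_) ?_
    · exact (Finset.single_le_sum (fun _ _ => Nat.zero_le _) (Finset.mem_univ i)).trans
        (Nat.le_succ _)
    · rw [← Finset.sum_pair hik]
      exact (Finset.sum_le_sum_of_subset (Finset.subset_univ _)).trans (Nat.le_succ _)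
    · nlinarith [Nat.zero_le (∑ i, m i)]
  have hXl := isLeast_regularityIndex hm ⟨_, (hX _).2 (hVsum.of_veronese hd hc)⟩
  have hVl := isLeast_regularityIndex hm ⟨_, (hV _).2 hVsum⟩
  set r := regularityIndex (fun i => Projectivization.mk K (w i) (hw0 i)) m
  set r' := regularityIndex (fun i => Projectivization.mk K (veroneseVec d (w i))
    (veroneseVec_ne_zero d (hw0 i))) m
  have hdQ : (0 : ℚ) < d := by exact_mod_cast hd
  have hle : ⌈(r : ℚ) / (d : ℚ)⌉ ≤ r' := by
    obtain ⟨j, hj⟩ := Int.eq_ofNat_of_zero_le (nonneg_of_mem_independentDegrees hm hVl.1)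
    have h1 := hVl.1
    rw [hj, hV] at h1
    have h2 : r ≤ (d * j : ℕ) := hXl.2 ((hX _).2 (h1.of_veronese hd hc))
    rw [Int.ceil_le, div_le_iff₀ hdQ, hj, mul_comm]
    exact_mod_cast h2
  refine ⟨hXl, hVl, hle, ?_⟩
  rintro rfl hs2 hpair
  have hlow : ∑ i, (m i : ℤ) ≤ r + 1 := by
    obtain ⟨j, hj⟩ := Int.eq_ofNat_of_zero_le (nonneg_of_mem_independentDegrees hm hXl.1)
    have h1 := hXl.1
    rw [hj, hX] at h1
    rw [hj]
    exact_mod_cast h1.sum_le hm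
  have hge : ⌈(-1 + ∑ i, (m i : ℚ)) / (d : ℚ)⌉ ≤ ⌈(r : ℚ) / (d : ℚ)⌉ := by
    refine Int.ceil_mono ((div_le_div_iff_of_pos_right hdQ).2 ?_)
    have : ∑ i, (m i : ℚ) ≤ r + 1 := by exact_mod_cast hlow
    linarith
  have hup : r' ≤ ⌈(-1 + ∑ i, (m i : ℚ)) / (d : ℚ)⌉ := by
    have hpos : (1 : ℚ) ≤ ∑ i, (m i : ℚ) := by
      have h1 : m ⟨0, hs⟩ ≤ ∑ i, m i :=
        Finset.single_le_sum (fun _ _ => Nat.zero_le _) (Finset.mem_univ _)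
      exact_mod_cast (hm _).trans h1
    obtain ⟨t, ht⟩ := Int.eq_ofNat_of_zero_le (Int.ceil_nonneg
      (div_nonneg (by linarith : (0 : ℚ) ≤ -1 + ∑ i, (m i : ℚ)) hdQ.le))
    have h1 := Int.le_ceil ((-1 + ∑ i, (m i : ℚ)) / (d : ℚ))
    rw [ht, div_le_iff₀ hdQ] at h1
    have hsum : ∑ i, (m i : ℤ) ≤ d * t + 1 := by
      have : ∑ i, (m i : ℚ) ≤ d * t + 1 := by
        push_cast at h1
        linarith
      exact_mod_cast this
    have hlt : ∀ i k, i < k → m i + m k ≤ t + 1 := by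
      intro i k hik
      have h2 := hpair i k hik
      -- By `hsum`, `2d - 2 + ∑ m_i ≤ d * (t + 2) - 1`; strictness then gives `m i + m k ≤ t + 1`.
      have h3 : (d : ℤ) * ((m i : ℤ) + m k) < d * (t + 2) := by linarith
      have h4 := lt_of_mul_lt_mul_left h3 (Int.natCast_nonneg d)
      omega
    have hne : ∀ i k, i ≠ k → m i + m k ≤ t + 1 := by
      intro i k hik
      rcases lt_or_gt_of_ne hik with h | h
      · exact hlt i k h
      · rw [add_comm]
        exact hlt k i h
    rw [ht]
    refine hVl.2 ((hV t).2 (surjectiveOnJets_veronese hc hw (fun i => ?_) hne ?_))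
    -- With a second point available, the bound on a single multiplicity follows from the one on
    -- pairs.
    · have : Nontrivial (Fin s) := Fin.nontrivial_iff_two_le.2 hs2
      obtain ⟨k, hk⟩ := exists_ne i
      have := hne i k hk.symm
      omega
    · exact_mod_cast hsum
  exact ⟨le_antisymm hle (hup.trans hge), le_antisymm hup (hge.trans hle)⟩
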